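/- For $s\in\{0,1\}$ and $c\in\mathbb{R}$ let $\mathbb{Q}_s^{N}(c)$ denote the Riemannian ($s=0$) or Lorentzian ($s=1$) space form of dimension $N$, index $s$ and constant sectional curvature $c$: the pseudo-Euclidean space $\mathbb{R}^N_s$ if $c=0$, and the hyperquadric $\{x:\langle x,x\rangle=1/c\}$ with its induced metric in $\mathbb{R}^{N+1}_{s}$ if $c>0$, in $\mathbb{R}^{N+1}_{s+1}$ if $c<0$. Write $\epsilon=-2s+1$ and $\tilde\epsilon=-2\tilde s+1$. The principal curvatures of an isometric immersion of a Riemannian manifold $M^n$ into $\mathbb{Q}_s^{n+1}(c)$ at $x\in M^n$ are the eigenvalues of its shape operator $A_N$, given by $\langle A_NX,Y\rangle=\langle\alpha(X,Y),N\rangle$ where $\alpha$ is the second fundamental form and $N$ is a unit normal vector at $x$, that is, $\langle N,N\rangle=\epsilon$; multiplicities are the dimensions of the eigenspaces, and the immersion is umbilical at $x$ if $A_N$ is a multiple of the identity. **Theorem.** Let $n\geq 4$, let $M^n$ be a non-empty smooth Riemannian manifold of dimension $n$, let $s,\tilde s\in\{0,1\}$ and $c,\tilde c\in\mathbb{R}$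 with $\tilde c\neq c$, and let $f\colon M^n\to\mathbb{Q}_s^{n+1}(c)$ and $\tilde f\colon M^n\to\mathbb{Q}_{\tilde s}^{n+1}(\tilde c)$ be smooth isometric immersions. Then $c<\tilde c$ if $s=0$ and $\tilde s=1$, and $c>\tilde c$ if $s=1$ and $\tilde s=0$. Moreover, at every $x\in M^n$ and for every choice of unit normal vectors $N$ of $f$ and $\tilde N$ of $\tilde f$ at $x$, $f$ has a principal curvature $\lambda$ of multiplicity at least $n-1$ (with respect to $N$), and the following hold at $x$: (i) if $\lambda=0$, or if $f$ is umbilical and $c+\epsilon\lambda^2\neq\tilde c$, then $\tilde f$ is umbilical; (ii) if $f$ is umbilical and $c+\epsilon\lambda^2=\tilde c$, then $0$ is a principal curvature of $\tilde f$ of multiplicity at least $n-1$; (iii) if $\lambda\neq 0$ has multiplicity exactly $n-1$, then $\tilde f$ has a principal curvature $\tilde\lambda$ with the same eigenspace as $\lambda$. -/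

import Mathlib

open scoped Manifold ContDiff

noncomputable section

namespace SpaceForms

/-- The signs `η₀, η₁, …, η_N` of the flat ambient space `ℝ^{N+1}` that contains the space form
`Q_s^N(c)`: the coordinates `1, …, s` are time-like, and so is the coordinate `0` if `c < 0`;
all others are space-like. So the index is `s` if `c ≥ 0` and `s + 1` if `c < 0`. -/
def ambientSign (s : ℕ) (c : ℝ) {N : ℕ} (i : Fin (N + 1)) : ℝ :=
  if i = 0 then (if c < 0 then -1 else 1) else (if (i : ℕ) ≤ s then -1 else 1)

/-- The flat pseudo-Euclidean scalar product `⟨x, y⟩ = ∑ i, ηᵢ xᵢ yᵢ` of the ambient space. -/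
def ambientForm (s : ℕ) (c : ℝ) (N : ℕ) : LinearMap.BilinForm ℝ (Fin (N + 1) → ℝ) :=
  LinearMap.mk₂ ℝ (fun x y => ∑ i, ambientSign s c i * x i * y i)
    (fun x x' y => by
      rw [← Finset.sum_add_distrib]
      exact Finset.sum_congr rfl fun i _ => by simp only [Pi.add_apply]; ring)
    (fun a x y => by
      rw [smul_eq_mul, Finset.mul_sum]
      exact Finset.sum_congr rfl fun i _ => by simp only [Pi.smul_apply, smul_eq_mul]; ring)
    (fun x y y' => by
      rw [← Finset.sum_add_distrib]
      exact Finset.sum_congr rfl fun i _ => by simp only [Pi.add_apply]; ring)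
    (fun a x y => by
      rw [smul_eq_mul, Finset.mul_sum]
      exact Finset.sum_congr rfl fun i _ => by simp only [Pi.smul_apply, smul_eq_mul]; ring)

/-- The space form `Q_s^N(c)` of dimension `N`, index `s` and constant curvature `c`, as a
submanifold of the flat ambient space with its induced metric: the central hyperquadric
`⟨x, x⟩ = 1 / c` if `c ≠ 0`, and the hyperplane `x₀ = 0`, a copy of the pseudo-Euclidean space
`ℝ_s^N`, if `c = 0`. -/
def spaceForm (s : ℕ) (c : ℝ) (N : ℕ) : Set (Fin (N + 1) → ℝ) :=
  {x | if c = 0 then x 0 = 0 else ambientForm s c N x x = 1 / c}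

/-- The vector `v` of the ambient space is tangent to the space form at its point `p`. -/
def IsTangent (s : ℕ) (c : ℝ) (N : ℕ) (p v : Fin (N + 1) → ℝ) : Prop :=
  if c = 0 then v 0 = 0 else ambientForm s c N p v = 0

/-- The sign `ε = -2 s + 1`. -/
def sgn (s : ℕ) : ℝ := -2 * (s : ℝ) + 1

/-- A smooth Riemannian metric on a manifold of dimension `n`. -/
abbrev Metric (n : ℕ) (M : Type*) [TopologicalSpace M] [ChartedSpace (EuclideanSpace ℝ (Fin n)) M]
    [IsManifold (𝓡 n) ∞ M] :=
  Bundle.ContMDiffRiemannianMetric (𝓡 n) ∞ (EuclideanSpace ℝ (Fin n))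
    (fun x : M => TangentSpace (𝓡 n) x)

variable {n : ℕ} {M : Type*} [TopologicalSpace M] [ChartedSpace (EuclideanSpace ℝ (Fin n)) M]

/-- The map `f : M → Q_s^{n+1}(c)`, read in the ambient space. -/
def toAmbient {s : ℕ} {c : ℝ} (f : M → spaceForm s c (n + 1)) (x : M) : Fin (n + 1 + 1) → ℝ :=
  (f x : Fin (n + 1 + 1) → ℝ)

/-- The differential `T_xM → ℝ^{n+2}` of `f : M → Q_s^{n+1}(c)`, read in the ambient space. -/
def differential {s : ℕ} {c : ℝ} (f : M → spaceForm s c (n + 1)) (x : M) :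
    TangentSpace (𝓡 n) x →L[ℝ] (Fin (n + 1 + 1) → ℝ) :=
  mfderiv (𝓡 n) 𝓘(ℝ, Fin (n + 1 + 1) → ℝ) (toAmbient f) x

/-- `f : M → Q_s^{n+1}(c)` is a (smooth) isometric immersion of the Riemannian manifold `(M, g)`;
the differential is injective since `g` is positive definite. -/
structure IsIsometricImmersion [IsManifold (𝓡 n) ∞ M] (g : Metric n M) {s : ℕ} {c : ℝ}
    (f : M → spaceForm s c (n + 1)) : Prop where
  smooth : ContMDiff (𝓡 n) 𝓘(ℝ, Fin (n + 1 + 1) → ℝ) ∞ (toAmbient f)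
  isometric : ∀ (x : M) (X Y : TangentSpace (𝓡 n) x),
    ambientForm s c (n + 1) (differential f x X) (differential f x Y) = g.inner x X Y

/-- `v` is a unit normal vector of `f` at `x`: it is tangent to `Q_s^{n+1}(c)` at `f x`, it is
orthogonal to the image of the differential, and `⟨v, v⟩ = ε`. (As that image is positive definite
of codimension one, the normal line has the sign `ε`.) -/
structure IsUnitNormal {s : ℕ} {c : ℝ} (f : M → spaceForm s c (n + 1)) (x : M)
    (v : Fin (n + 1 + 1) → ℝ) : Prop where
  tangent : IsTangent s c (n + 1) (toAmbient f x) v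
  normal : ∀ X : TangentSpace (𝓡 n) x, ambientForm s c (n + 1) v (differential f x X) = 0
  unit : ambientForm s c (n + 1) v v = sgn s

/-- The second derivative at `x` of `f`, read in the preferred chart at `x` and in the ambient
space. (In Mathlib `T_xM` is the model space, through the preferred chart at `x`.) -/
def hessian {s : ℕ} {c : ℝ} (f : M → spaceForm s c (n + 1)) (x : M) :
    TangentSpace (𝓡 n) x →L[ℝ] TangentSpace (𝓡 n) x →L[ℝ] (Fin (n + 1 + 1) → ℝ) :=
  fderiv ℝ (fderiv ℝ (toAmbient f ∘ (extChartAt (𝓡 n) x).symm)) (extChartAt (𝓡 n) x x)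

/-- The second fundamental form `⟨α(X, Y), v⟩` of `f` at `x` in the direction of the vector `v`
normal to `f` and tangent to `Q_s^{n+1}(c)`. The vector `α(X, Y)` is the component normal to `f`
and tangent to `Q_s^{n+1}(c)` of the second derivative of `f` in the flat ambient space, so it has
the same scalar product with `v` as the second derivative; this does not depend on the chart. -/
def secondForm {s : ℕ} {c : ℝ} (f : M → spaceForm s c (n + 1)) (x : M)
    (v : Fin (n + 1 + 1) → ℝ) : LinearMap.BilinForm ℝ (TangentSpace (𝓡 n) x) :=
  LinearMap.mk₂ ℝ (fun X Y => ambientForm s c (n + 1) (hessian f x X Y) v)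
    (fun X X' Y => by simp) (fun a X Y => by simp) (fun X Y Y' => by simp) (fun a X Y => by simp)

variable [IsManifold (𝓡 n) ∞ M]

/-- The Riemannian metric at `x`, as a bilinear form. -/
def metricForm (g : Metric n M) (x : M) : LinearMap.BilinForm ℝ (TangentSpace (𝓡 n) x) :=
  LinearMap.mk₂ ℝ (fun X Y => g.inner x X Y)
    (fun X X' Y => by simp) (fun a X Y => by simp) (fun X Y Y' => by simp) (fun a X Y => by simp)

theorem metricForm_nondegenerate (g : Metric n M) (x : M) : (metricForm g x).Nondegenerate := by
  constructor
  · intro X hX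
    by_contra h
    exact (g.pos x X h).ne' (hX X)
  · intro X hX
    by_contra h
    exact (g.pos x X h).ne' (hX X)

instance (x : M) : FiniteDimensional ℝ (TangentSpace (𝓡 n) x) :=
  inferInstanceAs (FiniteDimensional ℝ (EuclideanSpace ℝ (Fin n)))

/-- The shape operator `A_v` of `f` at `x` in the direction of the normal vector `v`: the
endomorphism of `T_xM` with `⟨A_v X, Y⟩ = ⟨α(X, Y), v⟩` for all `X`, `Y`. -/
def shapeOperator (g : Metric n M) {s : ℕ} {c : ℝ} (f : M → spaceForm s c (n + 1)) (x : M)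
    (v : Fin (n + 1 + 1) → ℝ) : Module.End ℝ (TangentSpace (𝓡 n) x) :=
  ((metricForm g x).toDual (metricForm_nondegenerate g x)).symm.toLinearMap ∘ₗ secondForm f x v

theorem inner_shapeOperator (g : Metric n M) {s : ℕ} {c : ℝ} (f : M → spaceForm s c (n + 1))
    (x : M) (v : Fin (n + 1 + 1) → ℝ) (X Y : TangentSpace (𝓡 n) x) :
    g.inner x (shapeOperator g f x v X) Y = secondForm f x v X Y :=
  LinearMap.BilinForm.apply_toDual_symm_apply (B := metricForm g x)
    (hB := metricForm_nondegenerate g x) (secondForm f x v X) Y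

/-- The eigenspace of `A_v` for `κ`. -/
def principalSpace (g : Metric n M) {s : ℕ} {c : ℝ} (f : M → spaceForm s c (n + 1)) (x : M)
    (v : Fin (n + 1 + 1) → ℝ) (κ : ℝ) : Submodule ℝ (TangentSpace (𝓡 n) x) :=
  Module.End.eigenspace (shapeOperator g f x v) κ

/-- The multiplicity of `κ` as a principal curvature of `f` at `x` with respect to `v`, that is,
the dimension of its eigenspace (`0` if `κ` is not a principal curvature). -/
def multiplicity (g : Metric n M) {s : ℕ} {c : ℝ} (f : M → spaceForm s c (n + 1)) (x : M)
    (v : Fin (n + 1 + 1) → ℝ) (κ : ℝ) : ℕ :=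
  Module.finrank ℝ (principalSpace g f x v κ)

/-- `f` is umbilical at `x`, with principal curvature `κ` with respect to `v`: `A_v = κ I`. -/
def IsUmbilicalWith (g : Metric n M) {s : ℕ} {c : ℝ} (f : M → spaceForm s c (n + 1)) (x : M)
    (v : Fin (n + 1 + 1) → ℝ) (κ : ℝ) : Prop :=
  shapeOperator g f x v = κ • (1 : Module.End ℝ (TangentSpace (𝓡 n) x))

end SpaceForms

end

/-! The Gauss equations of `f` and `f'` express one curvature tensor in two ways. Put `D = c - c'`,
take an orthonormal eigenbasis of the shape operator `A` of `f` with eigenvalues `d i`, and let `a`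
be the matrix of the shape operator `A'` of `f'`. Then the 2×2 minors of `a` form a diagonal matrix
with entries `m i j = ε' (D + ε d i d j)`.

Two Laplace expansions of a 4×4 minor of `a` give `m i j * m k l = m i k * m j l`, that is, `D (d i
- d l) (d j - d k) = 0` for distinct indices. Hence all `d j` but one, `d i₀`, equal some `κ`
(`exists_forall_ne_eq`). Let `μ = ε' (D + ε κ²)`. If `μ ≠ 0`, then `a` is diagonal with entries `t`
off `i₀`, where `t² = μ` and `a i₀ i₀ * t = ε' (D + ε d i₀ κ)` (`exists_diagonal`). The sign
condition is `t² ≥ 0`, and comparing the two products decides whether `a i₀ i₀ = t`. If `μ = 0` and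
`f` is umbilical, all minors of `a` vanish and `A'` has rank at most one. If `μ = 0`, `κ ≠ 0` and `d
i₀ ≠ κ`, the minors are contradictory (`exists_ne_zero`).

The Gauss equations come from the map `(f, f')` into the product of the ambient spaces with the
difference of the two forms: its differential is isotropic, so its second derivative is orthogonal
to the first (`second_deriv_orthogonal`) and flat (`second_deriv_flat`). Splitting the second
derivatives into tangential, normal and transversal parts (`inner_hessian`) yields `gaussPair`. -/

noncomputable section

namespace SpaceForms

/-- A self-adjoint endomorphism for a positive definite symmetric form has an orthonormal basis
of eigenvectors. -/
theorem exists_orthonormal_eigenbasis {V : Type*} [AddCommGroup V] [Module ℝ V]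
    [FiniteDimensional ℝ V] {n : ℕ} (hn : Module.finrank ℝ V = n)
    (B : LinearMap.BilinForm ℝ V) (hB : ∀ x y, B x y = B y x) (hpos : ∀ x, x ≠ 0 → 0 < B x x)
    (A : Module.End ℝ V) (hA : ∀ x y, B (A x) y = B x (A y)) :
    ∃ (b : Module.Basis (Fin n) ℝ V) (d : Fin n → ℝ),
      (∀ i j, B (b i) (b j) = if i = j then 1 else 0) ∧ ∀ i, A (b i) = d i • b i := by
  let core : InnerProductSpace.Core ℝ V :=
    { inner := fun x y => B x y
      conj_inner_symm := fun x y => by simp [hB x y]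
      re_inner_nonneg := fun x => by
        rcases eq_or_ne x 0 with rfl | h
        · simp
        · exact (hpos x h).le
      add_left := fun x y z => by simp
      smul_left := fun x y r => by simp
      definite := fun x h => by
        by_contra hx
        exact (hpos x hx).ne' h }
  let _ : NormedAddCommGroup V := core.toNormedAddCommGroup
  let _ : InnerProductSpace ℝ V := InnerProductSpace.ofCore core.toCore
  have hsym : A.IsSymmetric := fun x y => hA x y
  let b := hsym.eigenvectorBasis hn
  refine ⟨b.toBasis, hsym.eigenvalues hn, fun i j => ?_, fun i => ?_⟩
  · rw [b.coe_toBasis]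
    exact orthonormal_iff_ite.1 b.orthonormal i j
  · rw [b.coe_toBasis]
    exact hsym.apply_eigenvectorBasis hn i

/-! ### Symmetric matrices with diagonal second compound. -/

section Minors

variable {n : ℕ} {a m : Fin n → Fin n → ℝ}

/-- The second compound of `a` is diagonal, with entries `m i j`. -/
def CompoundDiagonal (a m : Fin n → Fin n → ℝ) : Prop :=
  ∀ i j k l, a i k * a j l - a i l * a j k =
    m i j * ((if i = k then 1 else 0) * (if j = l then 1 else 0) -
      (if i = l then 1 else 0) * (if j = k then 1 else 0))

/-- Fewer exclusions are expressed by repeating an index. -/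
theorem exists_ne_three (hn : 4 ≤ n) (i j k : Fin n) : ∃ l, l ≠ i ∧ l ≠ j ∧ l ≠ k := by
  have : ({i, j, k} : Finset (Fin n)).card < (Finset.univ : Finset (Fin n)).card := by
    have := Finset.card_le_three (a := i) (b := j) (c := k)
    simp only [Finset.card_univ, Fintype.card_fin]
    omega
  obtain ⟨l, -, hl⟩ := Finset.exists_mem_notMem_of_card_lt_card this
  exact ⟨l, by simpa using hl⟩

namespace CompoundDiagonal

theorem minor_eq (h : CompoundDiagonal a m) {i j : Fin n} (hij : i ≠ j) :
    a i i * a j j - a i j * a j i = m i j := by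
  simpa [hij, hij.symm] using h i j i j

theorem minor_eq_zero (h : CompoundDiagonal a m) {i j k l : Fin n} (h1 : l ≠ i) (h2 : l ≠ j) :
    a i k * a j l - a i l * a j k = 0 := by
  simpa [h1.symm, h2.symm] using h i j k l

/-- Both products are the `4 × 4` minor of `a`, by Laplace expansion along two rows. -/
theorem mul_eq_mul (h : CompoundDiagonal a m) {i j k l : Fin n} (hij : i ≠ j) (hik : i ≠ k)
    (hil : i ≠ l) (hjk : j ≠ k) (hjl : j ≠ l) (hkl : k ≠ l) :
    m i j * m k l = m i k * m j l := by
  have Z : ∀ p q r t : Fin n, t ≠ p → t ≠ q → a p r * a q t - a p t * a q r = 0 :=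
    fun p q r t h1 h2 => h.minor_eq_zero h1 h2
  rw [← h.minor_eq hij, ← h.minor_eq hkl, ← h.minor_eq hik, ← h.minor_eq hjl]
  have e1 := Z i j i k hik.symm hjk.symm
  have e2 := Z i j i l hil.symm hjl.symm
  have e3 := Z i j j k hik.symm hjk.symm
  have e4 := Z i j j l hil.symm hjl.symm
  have e5 := Z i j k l hil.symm hjl.symm
  have f1 := Z i k i j hij.symm hjk
  have f2 := Z i k i l hil.symm hkl.symm
  have f3 := Z i k k j hij.symm hjk
  have f4 := Z i k k l hil.symm hkl.symm
  have f5 := Z i k j l hil.symm hkl.symm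
  -- The coefficients are the complementary minors: rows `k, l` for the `e`, rows `j, l` for the
  -- `f`, with Laplace signs.
  linear_combination (a k j * a l l - a k l * a l j) * e1 - (a k j * a l k - a k k * a l j) * e2
    - (a k i * a l l - a k l * a l i) * e3 + (a k i * a l k - a k k * a l i) * e4
    - (a k i * a l j - a k j * a l i) * e5
    - (a j k * a l l - a j l * a l k) * f1 + (a j k * a l j - a j j * a l k) * f2
    + (a j i * a l l - a j l * a l i) * f3 - (a j i * a l j - a j j * a l i) * f4
    + (a j i * a l k - a j k * a l i) * f5

/-- In rows `i, j` the columns `i` and `j` are independent, and column `k` is proportional to both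
of them, so it vanishes. -/
theorem apply_eq_zero (h : CompoundDiagonal a m) {i j k : Fin n} (hij : i ≠ j) (hm : m i j ≠ 0)
    (hki : k ≠ i) (hkj : k ≠ j) : a i k = 0 := by
  have e0 := h.minor_eq hij
  have e1 := h.minor_eq_zero (i := i) (j := j) (k := j) hki hkj
  have e2 := h.minor_eq_zero (i := i) (j := j) (k := i) hki hkj
  have : a i k * m i j = 0 := by
    rw [← e0]
    linear_combination a i j * e2 - a i i * e1
  exact (mul_eq_zero.1 this).resolve_right hm

/-- The pivot `j` leaves only the entry `a i j` open, and the pivot `l` covers it. -/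
theorem apply_eq_zero_of_two (h : CompoundDiagonal a m) {i j l : Fin n} (hij : i ≠ j)
    (hil : i ≠ l) (hjl : j ≠ l) (hj : m i j ≠ 0) (hl : m i l ≠ 0) {k : Fin n} (hki : k ≠ i) :
    a i k = 0 := by
  by_cases hkj : k = j
  · exact h.apply_eq_zero hil hl hki (hkj ▸ hjl)
  · exact h.apply_eq_zero hij hj hki hkj

/-- If all entries `m j l` with `j, l ≠ i₀` equal `μ ≠ 0`, then `a` is diagonal, and its diagonal
entries apart from that at `i₀` coincide. -/
theorem exists_diagonal (hn : 4 ≤ n) (h : CompoundDiagonal a m) (hsymm : ∀ i j, a i j = a j i)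
    {i₀ : Fin n} {μ : ℝ} (hμ : μ ≠ 0) (hm : ∀ i j, i ≠ i₀ → j ≠ i₀ → m i j = μ) :
    (∀ i j, i ≠ j → a i j = 0) ∧ ∃ t, t * t = μ ∧ (∀ j, j ≠ i₀ → a j j = t) ∧
      ∀ j, j ≠ i₀ → a i₀ i₀ * t = m i₀ j := by
  have row : ∀ i, i ≠ i₀ → ∀ k, k ≠ i → a i k = 0 := by
    intro i hi k hk
    obtain ⟨j, hji, hj, -⟩ := exists_ne_three hn i i₀ i₀
    obtain ⟨l, hli, hl, hlj⟩ := exists_ne_three hn i i₀ j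
    exact h.apply_eq_zero_of_two hji.symm hli.symm hlj.symm (by rw [hm i j hi hj]; exact hμ)
      (by rw [hm i l hi hl]; exact hμ) hk
  have diag : ∀ i j, i ≠ j → a i j = 0 := by
    intro i j hij
    by_cases hi : i = i₀
    -- Nothing is assumed about `m i₀ j`, so row `i₀` is reached through the symmetry of `a`.
    · rw [hsymm]
      exact row j (fun hj => hij (hi.trans hj.symm)) i hij
    · exact row i hi j hij.symm
  have prod : ∀ i j, i ≠ j → a i i * a j j = m i j := by
    intro i j hij
    have := h.minor_eq hij
    rw [diag i j hij] at this
    linarith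
  have eqd : ∀ i j, i ≠ i₀ → j ≠ i₀ → a i i = a j j := by
    intro i j hi hj
    by_cases hij : i = j
    · rw [hij]
    -- A common partner `k` gives `a i i * a k k = μ = a j j * a k k`.
    obtain ⟨k, hk, hki, hkj⟩ := exists_ne_three hn i₀ i j
    have e1 := prod i k hki.symm
    have e2 := prod j k hkj.symm
    rw [hm i k hi hk] at e1
    rw [hm j k hj hk] at e2
    have hk0 : a k k ≠ 0 := fun h0 => hμ (by rw [← e1, h0, mul_zero])
    exact mul_right_cancel₀ hk0 (e1.trans e2.symm)
  obtain ⟨j, hj, -⟩ := exists_ne_three hn i₀ i₀ i₀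
  obtain ⟨k, hk, hkj, -⟩ := exists_ne_three hn i₀ j j
  refine ⟨diag, a j j, ?_, fun l hl => eqd l j hl hj, fun l hl => ?_⟩
  · have := prod j k hkj.symm
    rwa [hm j k hj hk, eqd k j hk hj] at this
  · rw [eqd j l hj hl]
    exact prod i₀ l hl.symm

/-- The entries `m j l` with `j, l ≠ i₀` cannot all vanish if no entry `m i₀ j` does. -/
theorem exists_ne_zero (hn : 4 ≤ n) (h : CompoundDiagonal a m) {i₀ : Fin n}
    (h₀ : ∀ j, j ≠ i₀ → m i₀ j ≠ 0) : ∃ i j, i ≠ i₀ ∧ j ≠ i₀ ∧ m i j ≠ 0 := by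
  obtain ⟨j, hj, -⟩ := exists_ne_three hn i₀ i₀ i₀
  obtain ⟨k, hk, hkj, -⟩ := exists_ne_three hn i₀ j j
  refine ⟨j, k, hj, hk, fun hm => ?_⟩
  -- Row `i₀` has only its diagonal entry, so `a i₀ i₀`, `a j j`, `a k k` are non-zero; the mixed
  -- minor `e4` then forces `a j k = 0`, whence `m j k = a j j * a k k ≠ 0`.
  have row : ∀ l, l ≠ i₀ → a i₀ l = 0 := fun l hl =>
    h.apply_eq_zero_of_two hj.symm hk.symm hkj.symm (h₀ j hj) (h₀ k hk) hl
  have e1 := h.minor_eq hj.symm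
  have e2 := h.minor_eq hk.symm
  have e3 := h.minor_eq hkj.symm
  have e4 := h.minor_eq_zero (i := i₀) (j := j) (k := i₀) (l := k) hk hkj
  rw [row j hj] at e1
  rw [row k hk] at e2 e4
  have h1 := h₀ j hj
  have h2 := h₀ k hk
  simp only [zero_mul, sub_zero] at e1 e2 e4
  rw [← e1] at h1
  rw [← e2] at h2
  rw [(mul_eq_zero.1 e4).resolve_left (left_ne_zero_of_mul h1), hm, zero_mul, sub_zero] at e3
  exact mul_ne_zero (right_ne_zero_of_mul h1) (right_ne_zero_of_mul h2) e3

/-- If the second compound of some `a` is `r + t λᵢ λⱼ`, then all `λᵢ` but one coincide. -/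
theorem exists_forall_ne_eq (hn : 4 ≤ n) {d : Fin n → ℝ} {r t : ℝ} (hr : r ≠ 0) (ht : t ≠ 0)
    (h : CompoundDiagonal a fun i j => r + t * (d i * d j)) :
    ∃ i₀ κ, ∀ j, j ≠ i₀ → d j = κ := by
  have key : ∀ i j k l : Fin n, i ≠ j → i ≠ k → i ≠ l → j ≠ k → j ≠ l → k ≠ l →
      d i = d l ∨ d j = d k := by
    intro i j k l hij hik hil hjk hjl hkl
    have e := h.mul_eq_mul hij hik hil hjk hjl hkl
    have : r * t * ((d i - d l) * (d j - d k)) = 0 := by linear_combination e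
    rcases mul_eq_zero.1 ((mul_eq_zero.1 this).resolve_left (mul_ne_zero hr ht)) with h' | h'
    · exact Or.inl (sub_eq_zero.1 h')
    · exact Or.inr (sub_eq_zero.1 h')
  by_cases hall : ∀ i j, d i = d j
  · exact ⟨⟨0, by omega⟩, d ⟨0, by omega⟩, fun j _ => hall _ _⟩
  push Not at hall
  obtain ⟨i, l, hil'⟩ := hall
  have hil : i ≠ l := fun e => hil' (e ▸ rfl)
  obtain ⟨j, hji, hjl, -⟩ := exists_ne_three hn i l l
  -- Since `d i ≠ d l`, all other values coincide; the exceptional index is then `i` or `l`.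
  have rest : ∀ k, k ≠ i → k ≠ l → d k = d j := by
    intro k hki hkl
    by_cases hjk : j = k
    · rw [hjk]
    exact ((key i j k l hji.symm hki.symm hil hjk hjl hkl).resolve_left hil').symm
  by_cases hi : d i = d j
  · refine ⟨l, d j, fun k hk => ?_⟩
    by_cases hki : k = i
    · rw [hki, hi]
    · exact rest k hki hk
  · refine ⟨i, d j, fun k hk => ?_⟩
    by_cases hkl : k = l
    · obtain ⟨p, hpi, hpl, hpj⟩ := exists_ne_three hn i l j
      rw [hkl]
      refine ((key i l p j hil hpi.symm hji.symm hpl.symm hjl.symm hpj).resolve_left hi).trans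
        (rest p hpi hpl)
    · exact rest k hk hkl

end CompoundDiagonal

end Minors

/-! ### Eigenspaces of diagonal operators. -/

section Eigenspaces

variable {n : ℕ} {V : Type*} [AddCommGroup V] [Module ℝ V]

theorem mem_eigenspace_iff_of_diagonal (b : Module.Basis (Fin n) ℝ V) {A : Module.End ℝ V}
    {d : Fin n → ℝ} (hA : ∀ i, A (b i) = d i • b i) (κ : ℝ) (x : V) :
    x ∈ Module.End.eigenspace A κ ↔ ∀ i, d i = κ ∨ b.repr x i = 0 := by
  have hrepr : ∀ i, b.repr (A x) i = d i * b.repr x i := by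
    intro i
    have : A x = ∑ j, (b.repr x j * d j) • b j := by
      conv_lhs => rw [← b.sum_repr x, map_sum]
      exact Finset.sum_congr rfl fun j _ => by rw [map_smul, hA, smul_smul]
    rw [this, b.repr_sum_self, mul_comm]
  rw [Module.End.mem_eigenspace_iff, ← b.repr.injective.eq_iff, Finsupp.ext_iff]
  refine forall_congr' fun i => ?_
  rw [hrepr, map_smul, Finsupp.smul_apply, smul_eq_mul, mul_eq_mul_right_iff]

theorem le_finrank_eigenspace [FiniteDimensional ℝ V] (b : Module.Basis (Fin n) ℝ V)
    {A : Module.End ℝ V} {d : Fin n → ℝ}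
    (hA : ∀ i, A (b i) = d i • b i) {i₀ : Fin n} {κ : ℝ} (hd : ∀ j, j ≠ i₀ → d j = κ) :
    n - 1 ≤ Module.finrank ℝ (Module.End.eigenspace A κ) := by
  have hk : LinearMap.ker (b.coord i₀) ≤ Module.End.eigenspace A κ := by
    intro x hx
    rw [mem_eigenspace_iff_of_diagonal b hA]
    intro i
    by_cases hi : i = i₀
    · exact Or.inr (hi ▸ hx)
    · exact Or.inl (hd i hi)
  have h1 := Submodule.finrank_mono hk
  have h2 := LinearMap.finrank_range_add_finrank_ker (b.coord i₀)
  have h3 : Module.finrank ℝ (LinearMap.range (b.coord i₀)) ≤ 1 :=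
    (Submodule.finrank_le _).trans (by simp)
  have h4 : Module.finrank ℝ V = n := by simp [Module.finrank_eq_card_basis b]
  omega

theorem eq_smul_one_of_diagonal (b : Module.Basis (Fin n) ℝ V) {A : Module.End ℝ V} {κ : ℝ}
    (hA : ∀ i, A (b i) = κ • b i) : A = κ • (1 : Module.End ℝ V) :=
  b.ext fun i => by simp [hA]

theorem eigenvalue_eq_of_eq_smul_one (b : Module.Basis (Fin n) ℝ V) {A : Module.End ℝ V}
    {d : Fin n → ℝ} (hA : ∀ i, A (b i) = d i • b i) {κ : ℝ}
    (h : A = κ • (1 : Module.End ℝ V)) (i : Fin n) : d i = κ := by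
  have : d i • b i = κ • b i := by rw [← hA, h]; simp
  exact smul_left_injective ℝ (b.ne_zero i) this

end Eigenspaces

/-! ### Algebraic consequences of the Gauss equations at a point. -/

section Gauss

variable {n : ℕ} {V : Type*} [AddCommGroup V] [Module ℝ V]

/-- The Gauss equations of two hypersurfaces with the metric `g` and shape operators `A`, `A'`, in
ambient spaces whose curvatures differ by `D`, with unit normals of signs `ε`, `ε'`: the two
expressions for the curvature tensor of `g` agree. -/
def GaussPair (g : LinearMap.BilinForm ℝ V) (D ε ε' : ℝ) (A A' : Module.End ℝ V) : Prop :=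
  ∀ X Y Z W, D * (g X Z * g Y W - g X W * g Y Z) +
    ε * (g (A X) Z * g (A Y) W - g (A X) W * g (A Y) Z) =
      ε' * (g (A' X) Z * g (A' Y) W - g (A' X) W * g (A' Y) Z)

variable {g : LinearMap.BilinForm ℝ V} {D ε ε' : ℝ} {A A' : Module.End ℝ V}

/-- As `ε'` is its own inverse, multiplying by it isolates the minors of `A'`. -/
theorem GaussPair.compoundDiagonal (h : GaussPair g D ε ε' A A') (hε' : ε' * ε' = 1)
    {b : Module.Basis (Fin n) ℝ V} {d : Fin n → ℝ}
    (hb : ∀ i j, g (b i) (b j) = if i = j then 1 else 0) (hA : ∀ i, A (b i) = d i • b i) :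
    CompoundDiagonal (fun i j => g (A' (b i)) (b j))
      fun i j => ε' * D + ε' * ε * (d i * d j) := by
  intro i j k l
  have e := h (b i) (b j) (b k) (b l)
  simp only [hA, map_smul, LinearMap.smul_apply, smul_eq_mul, hb] at e
  linear_combination (-ε') * e - (g (A' (b i)) (b k) * g (A' (b j)) (b l) -
    g (A' (b i)) (b l) * g (A' (b j)) (b k)) * hε'

theorem eq_of_forall_basis (hpos : ∀ x, x ≠ 0 → 0 < g x x) (b : Module.Basis (Fin n) ℝ V) {x y : V}
    (h : ∀ j, g x (b j) = g y (b j)) : x = y := by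
  have e : g x = g y := b.ext h
  by_contra hne
  have := hpos (x - y) (sub_ne_zero.2 hne)
  rw [map_sub g, e, sub_self] at this
  simp at this

/-- A self-adjoint operator with vanishing second compound has rank at most one. -/
theorem le_finrank_eigenspace_zero [FiniteDimensional ℝ V] (hn : Module.finrank ℝ V = n)
    (hpos : ∀ x, x ≠ 0 → 0 < g x x)
    (h : ∀ X Y Z W, g (A' X) Z * g (A' Y) W - g (A' X) W * g (A' Y) Z = 0) :
    n - 1 ≤ Module.finrank ℝ (Module.End.eigenspace A' 0) := by
  rw [Module.End.eigenspace_zero]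
  by_cases h0 : ∃ X Z, g (A' X) Z ≠ 0
  · obtain ⟨X, Z, hXZ⟩ := h0
    have hk : LinearMap.ker (g.flip Z ∘ₗ A') ≤ LinearMap.ker A' := by
      intro Y hY
      have hY' : g (A' Y) Z = 0 := hY
      rw [LinearMap.mem_ker]
      by_contra hne
      -- With `W = A' Y` the relation becomes `g (A' X) Z * g (A' Y) (A' Y) = 0`.
      have e := h X Y Z (A' Y)
      rw [hY', mul_zero, sub_zero] at e
      exact (mul_ne_zero hXZ (hpos _ hne).ne') e
    have h1 := Submodule.finrank_mono hk
    have h2 := LinearMap.finrank_range_add_finrank_ker (g.flip Z ∘ₗ A')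
    have h3 : Module.finrank ℝ (LinearMap.range (g.flip Z ∘ₗ A')) ≤ 1 :=
      (Submodule.finrank_le _).trans (by simp)
    omega
  · push Not at h0
    have : A' = 0 := by
      ext X
      by_contra hne
      exact (hpos _ hne).ne' (h0 _ _)
    rw [this, LinearMap.ker_zero, finrank_top, hn]
    omega

/-- The pointwise theorem in linear algebra. One partner of `A` suffices to produce `κ`, which then
serves every `A'`. -/
theorem exists_principal_curvature [FiniteDimensional ℝ V] (hn : 4 ≤ n)
    (hV : Module.finrank ℝ V = n) (hg : ∀ x y, g x y = g y x) (hpos : ∀ x, x ≠ 0 → 0 < g x x)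
    (hD : D ≠ 0) (hε : ε * ε = 1) (hε' : ε' * ε' = 1) (hA : ∀ x y, g (A x) y = g x (A y))
    (hex : ∃ A', GaussPair g D ε ε' A A') :
    ∃ κ : ℝ, n - 1 ≤ Module.finrank ℝ (Module.End.eigenspace A κ) ∧
      ∀ A' : Module.End ℝ V, (∀ x y, g (A' x) y = g x (A' y)) → GaussPair g D ε ε' A A' →
        (ε = 1 → ε' = -1 → D < 0) ∧
        ((κ = 0 ∨ (A = κ • (1 : Module.End ℝ V) ∧ D + ε * κ ^ 2 ≠ 0)) →
          ∃ κ' : ℝ, A' = κ' • (1 : Module.End ℝ V)) ∧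
        (A = κ • (1 : Module.End ℝ V) ∧ D + ε * κ ^ 2 = 0 →
          n - 1 ≤ Module.finrank ℝ (Module.End.eigenspace A' 0)) ∧
        (κ ≠ 0 ∧ Module.finrank ℝ (Module.End.eigenspace A κ) = n - 1 →
          ∃ κ' : ℝ, Module.End.eigenspace A' κ' = Module.End.eigenspace A κ) := by
  have hε0 : ε ≠ 0 := fun h => by simp [h] at hε
  have hε'0 : ε' ≠ 0 := fun h => by simp [h] at hε'
  obtain ⟨b, d, hb, hd⟩ := exists_orthonormal_eigenbasis hV g hg hpos A hA
  obtain ⟨i₀, κ, hκ⟩ : ∃ i₀ κ, ∀ j, j ≠ i₀ → d j = κ := by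
    obtain ⟨A₀, h₀⟩ := hex
    exact (h₀.compoundDiagonal hε' hb hd).exists_forall_ne_eq hn (mul_ne_zero hε'0 hD)
      (mul_ne_zero hε'0 hε0)
  refine ⟨κ, le_finrank_eigenspace b hd hκ, fun A' hA' hG => ?_⟩
  have hC := hG.compoundDiagonal hε' hb hd
  have hs : ∀ i j, g (A' (b i)) (b j) = g (A' (b j)) (b i) := fun i j => by
    rw [hA', hg]
  have hm : ∀ i j, i ≠ i₀ → j ≠ i₀ →
      ε' * D + ε' * ε * (d i * d j) = ε' * (D + ε * κ ^ 2) := fun i j hi hj => by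
    rw [hκ i hi, hκ j hj]; ring
  have hm₀ : ∀ j, j ≠ i₀ → ε' * D + ε' * ε * (d i₀ * d j) = ε' * (D + ε * (d i₀ * κ)) :=
    fun j hj => by rw [hκ j hj]; ring
  obtain ⟨j₀, hj₀, -⟩ := exists_ne_three hn i₀ i₀ i₀
  have main : D + ε * κ ^ 2 ≠ 0 → ∃ t, t * t = ε' * (D + ε * κ ^ 2) ∧
      ∃ d' : Fin n → ℝ, (∀ i, A' (b i) = d' i • b i) ∧ (∀ j, j ≠ i₀ → d' j = t) ∧
        d' i₀ * t = ε' * (D + ε * (d i₀ * κ)) := by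
    intro hne
    obtain ⟨hdiag, t, ht, hjt, hi₀⟩ := hC.exists_diagonal hn hs (mul_ne_zero hε'0 hne) hm
    refine ⟨t, ht, fun i => g (A' (b i)) (b i), fun i => ?_, hjt, ?_⟩
    · refine eq_of_forall_basis hpos b fun j => ?_
      rw [map_smul, LinearMap.smul_apply, hb, smul_eq_mul]
      by_cases hij : i = j
      · rw [← hij]; simp
      · rw [hdiag i j hij, if_neg hij, mul_zero]
    · rw [← hm₀ j₀ hj₀]
      exact hi₀ j₀ hj₀
  -- Here `d' i₀ * t = t * t` with `t ≠ 0`.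
  have umb : D + ε * κ ^ 2 ≠ 0 → d i₀ * κ = κ ^ 2 → ∃ κ' : ℝ, A' = κ' • (1 : Module.End ℝ V) := by
    intro hne he
    obtain ⟨t, ht, d', hd', hjt, hi₀⟩ := main hne
    rw [he, ← ht] at hi₀
    have ht0 : t ≠ 0 := fun h0 => mul_ne_zero hε'0 hne (by rw [← ht, h0, mul_zero])
    refine ⟨t, eq_smul_one_of_diagonal b fun i => ?_⟩
    rw [hd']
    by_cases hi : i = i₀
    · rw [hi, mul_right_cancel₀ ht0 hi₀]
    · rw [hjt i hi]
  refine ⟨fun h1 h2 => ?_, ?_, ?_, ?_⟩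
  -- If `D > 0`, then `t * t = -(D + κ ^ 2) < 0`.
  · by_contra hlt
    have hDp : 0 < D := lt_of_le_of_ne (not_lt.1 hlt) hD.symm
    have hp : 0 < D + ε * κ ^ 2 := by rw [h1]; positivity
    obtain ⟨t, ht, -⟩ := main hp.ne'
    rw [h2] at ht
    nlinarith [mul_self_nonneg t]
  · rintro (h0 | ⟨hu, hne⟩)
    · exact umb (by rw [h0]; simpa using hD) (by rw [h0]; simp)
    · exact umb hne (by rw [eigenvalue_eq_of_eq_smul_one b hd hu i₀, sq])
  · rintro ⟨hu, h0⟩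
    refine le_finrank_eigenspace_zero hV hpos fun X Y Z W => ?_
    have e := hG X Y Z W
    simp only [hu, LinearMap.smul_apply, Module.End.one_apply, map_smul, smul_eq_mul] at e
    refine (mul_eq_zero.1 (?_ : ε' * _ = 0)).resolve_left hε'0
    rw [← e]
    linear_combination (g X Z * g Y W - g X W * g Y Z) * h0
  · rintro ⟨hκ0, hmult⟩
    have hne : d i₀ ≠ κ := by
      intro he
      have : A = κ • (1 : Module.End ℝ V) := eq_smul_one_of_diagonal b fun i => by
        rw [hd]
        by_cases hi : i = i₀
        · rw [hi, he]
        · rw [hκ i hi]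
      have htop : Module.End.eigenspace A κ = ⊤ := by
        rw [eq_top_iff]
        intro x _
        rw [Module.End.mem_eigenspace_iff, this]
        simp
      rw [htop, finrank_top, hV] at hmult
      omega
    -- Otherwise `m i₀ j = ε' ε κ (d i₀ - κ) ≠ 0`, while all the other off-diagonal `m i j` vanish.
    have hμ : D + ε * κ ^ 2 ≠ 0 := by
      intro h0
      obtain ⟨i, j, hi, hj, hij⟩ := hC.exists_ne_zero hn (i₀ := i₀) fun j hj => by
        rw [hm₀ j hj]
        refine mul_ne_zero hε'0 fun h1 => ?_
        have : ε * κ * (d i₀ - κ) = 0 := by linear_combination h1 - h0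
        exact mul_ne_zero (mul_ne_zero hε0 hκ0) (sub_ne_zero.2 hne) this
      rw [hm i j hi hj, h0, mul_zero] at hij
      exact hij rfl
    obtain ⟨t, ht, d', hd', hjt, hi₀⟩ := main hμ
    have hne' : d' i₀ ≠ t := by
      intro he
      rw [he, ht] at hi₀
      have : ε' * ε * κ * (d i₀ - κ) = 0 := by linear_combination -hi₀
      exact mul_ne_zero (mul_ne_zero (mul_ne_zero hε'0 hε0) hκ0) (sub_ne_zero.2 hne) this
    -- Both eigenspaces are spanned by the `b j` with `j ≠ i₀`.
    refine ⟨t, ?_⟩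
    ext x
    rw [mem_eigenspace_iff_of_diagonal b hd', mem_eigenspace_iff_of_diagonal b hd]
    refine forall_congr' fun i => ?_
    by_cases hi : i = i₀
    · rw [hi]; simp [hne, hne']
    · simp [hκ i hi, hjt i hi]

end Gauss

/-! ### Maps with isotropic differential. -/

section FlatBilinear

variable {E Q : Type*} [NormedAddCommGroup E] [NormedSpace ℝ E]
  [NormedAddCommGroup Q] [NormedSpace ℝ Q] {b : Q →L[ℝ] Q →L[ℝ] ℝ} {Φ : E → Q} {y : E}

/-- If `Φ` has isotropic differential for `b`, then the second derivatives are orthogonal to the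
first. -/
theorem second_deriv_orthogonal (hb : ∀ p q, b p q = b q p) (hΦ : ContDiffAt ℝ 2 Φ y)
    (h : ∀ᶠ z in nhds y, ∀ X Y, b (fderiv ℝ Φ z X) (fderiv ℝ Φ z Y) = 0) (X Y Z : E) :
    b (fderiv ℝ (fderiv ℝ Φ) y X Y) (fderiv ℝ Φ y Z) = 0 := by
  have hsymm : ∀ X Y, fderiv ℝ (fderiv ℝ Φ) y X Y = fderiv ℝ (fderiv ℝ Φ) y Y X :=
    fun X Y => (hΦ.isSymmSndFDerivAt (by simp)).eq X Y
  have hd : DifferentiableAt ℝ (fderiv ℝ Φ) y :=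
    (hΦ.fderiv_right (m := 1) (by norm_num)).differentiableAt (by norm_num)
  have key : ∀ X Y Z, b (fderiv ℝ Φ y Y) (fderiv ℝ (fderiv ℝ Φ) y X Z) +
      b (fderiv ℝ (fderiv ℝ Φ) y X Y) (fderiv ℝ Φ y Z) = 0 := by
    intro X Y Z
    have e1 := b.hasFDerivAt_of_bilinear (hd.hasFDerivAt.clm_apply (hasFDerivAt_const Y y))
      (hd.hasFDerivAt.clm_apply (hasFDerivAt_const Z y))
    have e2 : (fun z => b (fderiv ℝ Φ z Y) (fderiv ℝ Φ z Z)) =ᶠ[nhds y] fun _ => 0 :=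
      h.mono fun z hz => hz Y Z
    have e3 := e1.unique ((hasFDerivAt_const (0 : ℝ) y).congr_of_eventuallyEq e2)
    simpa using congrArg (fun l => l X) e3
  -- The Koszul trick: the first identity plus the third minus the second leaves twice the desired
  -- term.
  have k1 := key X Y Z
  have k2 := key Z X Y
  have k3 := key Y Z X
  rw [hb (fderiv ℝ Φ y Y)] at k1
  rw [hb (fderiv ℝ Φ y X)] at k2
  rw [hb (fderiv ℝ Φ y Z)] at k3
  rw [hsymm Z Y, hsymm Z X] at k2
  rw [hsymm Y X] at k3
  linarith

/-- If `Φ` has isotropic differential for `b`, then its second derivative is flat for `b`. -/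
theorem second_deriv_flat (hb : ∀ p q, b p q = b q p) (hΦ : ContDiffAt ℝ 3 Φ y)
    (h : ∀ᶠ z in nhds y, ∀ X Y, b (fderiv ℝ Φ z X) (fderiv ℝ Φ z Y) = 0) (X Y Z W : E) :
    b (fderiv ℝ (fderiv ℝ Φ) y X Z) (fderiv ℝ (fderiv ℝ Φ) y Y W) =
      b (fderiv ℝ (fderiv ℝ Φ) y X W) (fderiv ℝ (fderiv ℝ Φ) y Y Z) := by
  have h1 : ContDiffAt ℝ 2 (fderiv ℝ Φ) y := hΦ.fderiv_right (by norm_num)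
  have h2 : ContDiffAt ℝ 1 (fderiv ℝ (fderiv ℝ Φ)) y := h1.fderiv_right (by norm_num)
  have hd : DifferentiableAt ℝ (fderiv ℝ Φ) y := h1.differentiableAt (by norm_num)
  have hd2 : DifferentiableAt ℝ (fderiv ℝ (fderiv ℝ Φ)) y := h2.differentiableAt (by norm_num)
  have hev : ∀ᶠ z in nhds y, ∀ X Y Z,
      b (fderiv ℝ (fderiv ℝ Φ) z X Y) (fderiv ℝ Φ z Z) = 0 := by
    filter_upwards [h.eventually_nhds, hΦ.eventually (by norm_num)] with z hz hz'
    exact second_deriv_orthogonal hb (hz'.of_le (by norm_num)) hz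
  have hsymm : ∀ X Y, fderiv ℝ (fderiv ℝ (fderiv ℝ Φ)) y X Y =
      fderiv ℝ (fderiv ℝ (fderiv ℝ Φ)) y Y X :=
    fun X Y => (h1.isSymmSndFDerivAt (by simp)).eq X Y
  have hs0 : ∀ X Y, fderiv ℝ (fderiv ℝ Φ) y X Y = fderiv ℝ (fderiv ℝ Φ) y Y X :=
    fun X Y => ((hΦ.of_le (m := 2) (by norm_num)).isSymmSndFDerivAt (by simp)).eq X Y
  have key : ∀ W X Z Y,
      b (fderiv ℝ (fderiv ℝ Φ) y X Z) (fderiv ℝ (fderiv ℝ Φ) y W Y) +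
      b (fderiv ℝ (fderiv ℝ (fderiv ℝ Φ)) y W X Z) (fderiv ℝ Φ y Y) = 0 := by
    intro W X Z Y
    have e1 := b.hasFDerivAt_of_bilinear
      ((hd2.hasFDerivAt.clm_apply (hasFDerivAt_const X y)).clm_apply (hasFDerivAt_const Z y))
      (hd.hasFDerivAt.clm_apply (hasFDerivAt_const Y y))
    have e2 : (fun z => b (fderiv ℝ (fderiv ℝ Φ) z X Z) (fderiv ℝ Φ z Y)) =ᶠ[nhds y]
        fun _ => 0 := hev.mono fun z hz => hz X Z Y
    have e3 := e1.unique ((hasFDerivAt_const (0 : ℝ) y).congr_of_eventuallyEq e2)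
    simpa using congrArg (fun l => l W) e3
  have hs3 : ∀ X Z W, fderiv ℝ (fderiv ℝ (fderiv ℝ Φ)) y W X Z =
      fderiv ℝ (fderiv ℝ (fderiv ℝ Φ)) y W Z X := by
    intro X Z W
    have e1 := (hd2.hasFDerivAt.clm_apply (hasFDerivAt_const X y)).clm_apply (hasFDerivAt_const Z y)
    have e2 := (hd2.hasFDerivAt.clm_apply (hasFDerivAt_const Z y)).clm_apply (hasFDerivAt_const X y)
    have e3 : (fun z => fderiv ℝ (fderiv ℝ Φ) z X Z) =ᶠ[nhds y]
        fun z => fderiv ℝ (fderiv ℝ Φ) z Z X := by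
      filter_upwards [hΦ.eventually (by norm_num)] with z hz
      exact ((hz.of_le (m := 2) (by norm_num)).isSymmSndFDerivAt (by simp)).eq X Z
    simpa using congrArg (fun l => l W) (e1.unique (e2.congr_of_eventuallyEq e3))
  -- By symmetry of the third derivative both identities contain the same third-order term, which
  -- cancels.
  have k1 := key W X Z Y
  have k2 := key Z X W Y
  rw [hs3 X Z W, hsymm W Z, hs3 W X Z] at k1
  rw [hs0 Y W, hs0 Y Z]
  linarith

end FlatBilinear

/-! ### Normals and signatures in the ambient space. -/

section Ambient

variable {s : ℕ} {c : ℝ} {N : ℕ}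

theorem ambientForm_apply (x y : Fin (N + 1) → ℝ) :
    ambientForm s c N x y = ∑ i, ambientSign s c i * x i * y i := rfl

theorem ambientForm_comm (x y : Fin (N + 1) → ℝ) :
    ambientForm s c N x y = ambientForm s c N y x := by
  simp only [ambientForm_apply]
  exact Finset.sum_congr rfl fun i _ => by ring

theorem ambientForm_pos {w : Fin (N + 1) → ℝ} (hw : w ≠ 0)
    (h : ∀ i, w i = 0 ∨ 0 < ambientSign s c i) : 0 < ambientForm s c N w w := by
  obtain ⟨i, hi⟩ := Function.ne_iff.1 hw
  refine Finset.sum_pos' (fun j _ => ?_) ⟨i, Finset.mem_univ i, ?_⟩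
  · rcases h j with h0 | h0
    · simp [h0]
    · nlinarith [mul_nonneg h0.le (mul_self_nonneg (w j))]
  · rw [mul_assoc]
    exact mul_pos ((h i).resolve_left hi) (mul_self_pos.2 hi)

theorem ambientForm_neg {w : Fin (N + 1) → ℝ} (hw : w ≠ 0)
    (h : ∀ i, w i = 0 ∨ ambientSign s c i < 0) : ambientForm s c N w w < 0 := by
  obtain ⟨i, hi⟩ := Function.ne_iff.1 hw
  refine Finset.sum_neg' (fun j _ => ?_) ⟨i, Finset.mem_univ i, ?_⟩
  · rcases h j with h0 | h0
    · simp [h0]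
    · nlinarith [mul_nonneg (neg_nonneg.2 h0.le) (mul_self_nonneg (w j))]
  · rw [mul_assoc]
    exact mul_neg_of_neg_of_pos ((h i).resolve_left hi) (mul_self_pos.2 hi)

variable {n : ℕ} {T : Type*} [AddCommGroup T] [Module ℝ T] [FiniteDimensional ℝ T]
  {L : T →ₗ[ℝ] (Fin (n + 1 + 1) → ℝ)} {u v : Fin (n + 1 + 1) → ℝ}

/-- The tangent space of a hypersurface, its normal and the position vector span the ambient
space. -/
theorem exists_decomposition (hT : Module.finrank ℝ T = n)
    (hL : ∀ X, X ≠ 0 → 0 < ambientForm s c (n + 1) (L X) (L X))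
    (hu : ambientForm s c (n + 1) u u ≠ 0) (huL : ∀ X, ambientForm s c (n + 1) u (L X) = 0)
    (hv : v ≠ 0) (huv : ambientForm s c (n + 1) u v = 0)
    (hvL : ∀ X, ambientForm s c (n + 1) v (L X) = 0) (w : Fin (n + 1 + 1) → ℝ) :
    ∃ (X : T) (t r : ℝ), w = L X + t • v + r • u := by
  let K : (T × ℝ) × ℝ →ₗ[ℝ] (Fin (n + 1 + 1) → ℝ) :=
    (L.coprod (LinearMap.toSpanSingleton ℝ _ v)).coprod (LinearMap.toSpanSingleton ℝ _ u)
  have hK : ∀ X t r, K ((X, t), r) = L X + t • v + r • u := fun X t r => by simp [K]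
  have hinj : Function.Injective K := by
    rw [injective_iff_map_eq_zero]
    rintro ⟨⟨X, t⟩, r⟩ h
    rw [hK] at h
    -- Products with `u` and `L X` isolate `r` and `X`, so no knowledge of `⟨v, v⟩` is needed.
    have e1 := congrArg (fun z => ambientForm s c (n + 1) u z) h
    have e2 := congrArg (fun z => ambientForm s c (n + 1) (L X) z) h
    simp only [map_add, map_smul, huL, huv, smul_eq_mul, map_zero, mul_zero, add_zero,
      zero_add, ambientForm_comm (L X) u, ambientForm_comm (L X) v, hvL] at e1 e2
    have hr : r = 0 := (mul_eq_zero.1 e1).resolve_right hu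
    have hX : X = 0 := by
      by_contra hX
      exact (hL X hX).ne' e2
    rw [hr, hX] at h
    simp only [map_zero, zero_smul, add_zero, zero_add] at h
    rw [hr, hX, (smul_eq_zero.1 h).resolve_right hv]
    rfl
  have hsurj : Function.Surjective K :=
    (LinearMap.injective_iff_surjective_of_finrank_eq_finrank (by simp [hT])).1 hinj
  obtain ⟨⟨⟨X, t⟩, r⟩, h⟩ := hsurj w
  exact ⟨X, t, r, by rw [← h, hK]⟩

/-- The normal line of a Riemannian hypersurface in a Riemannian or Lorentzian space form has the
sign `ε`. -/
theorem normal_sign (hs : s = 0 ∨ s = 1) (hT : Module.finrank ℝ T = n)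
    (hL : ∀ X, X ≠ 0 → 0 < ambientForm s c (n + 1) (L X) (L X))
    (hu : ambientForm s c (n + 1) u u ≠ 0) (huc : ambientForm s c (n + 1) u u < 0 ↔ c < 0)
    (huL : ∀ X, ambientForm s c (n + 1) u (L X) = 0)
    (hv : v ≠ 0) (huv : ambientForm s c (n + 1) u v = 0)
    (hvL : ∀ X, ambientForm s c (n + 1) v (L X) = 0) :
    0 < sgn s * ambientForm s c (n + 1) v v := by
  have hu0 : u ≠ 0 := fun h => hu (by simp [h])
  have hLnn : ∀ X, 0 ≤ ambientForm s c (n + 1) (L X) (L X) := fun X => by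
    rcases eq_or_ne X 0 with rfl | h
    · simp
    · exact (hL X h).le
  have hvv : ∀ (X : T) (t r : ℝ), ambientForm s c (n + 1) (L X + t • v + r • u) (L X + t • v + r • u) =
      ambientForm s c (n + 1) (L X) (L X) + t ^ 2 * ambientForm s c (n + 1) v v +
        r ^ 2 * ambientForm s c (n + 1) u u := fun X t r => by
    simp only [map_add, map_smul, LinearMap.add_apply, LinearMap.smul_apply, smul_eq_mul, huL, huv,
      hvL, ambientForm_comm (L X) u, ambientForm_comm (L X) v, ambientForm_comm v u]
    ring
  have hdec := exists_decomposition hT hL hu huL hv huv hvL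
  rcases hs with rfl | rfl
  · suffices 0 < ambientForm 0 c (n + 1) v v by simpa [sgn] using this
    by_cases hc : c < 0
    · have huu := huc.2 hc
      have hpos : ∀ w : Fin (n + 1 + 1) → ℝ, w ≠ 0 → w 0 = 0 →
          0 < ambientForm 0 c (n + 1) w w := fun w hw h0 => ambientForm_pos hw fun i => by
        by_cases hi : i = 0
        · exact Or.inl (hi ▸ h0)
        · exact Or.inr (by simp [ambientSign, hi])
      have h00 : u 0 ≠ 0 := fun h0 => (hpos u hu0 h0).not_gt huu
      -- This `t` moves `v` along `u` into the hyperplane `x₀ = 0`, where the form is positive.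
      set t := v 0 / u 0 with ht
      have hw : v - t • u ≠ 0 := by
        intro h
        rw [sub_eq_zero] at h
        rw [h, map_smul, smul_eq_mul] at huv
        rw [(mul_eq_zero.1 huv).resolve_right hu, zero_smul] at h
        exact hv h
      have h1 := hpos _ hw (by simp [ht, h00])
      simp only [map_sub, map_smul, LinearMap.sub_apply, LinearMap.smul_apply, smul_eq_mul,
        ambientForm_comm v u, huv] at h1
      nlinarith [mul_nonneg (sq_nonneg t) (neg_nonneg.2 huu.le)]
    · exact ambientForm_pos hv fun i => Or.inr (by
        by_cases hi : i = 0 <;> simp [ambientSign, hc, hi])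
  · suffices ambientForm 1 c (n + 1) v v < 0 by
      simp only [sgn]
      norm_num
      exact this
    by_cases hc : c < 0
    · have huu := huc.2 hc
      -- A vector orthogonal to `u` in the negative definite plane of the coordinates `0, 1`; it has
      -- no `u`-component, so its negative square must come from `v`.
      let w : Fin (n + 1 + 1) → ℝ := fun i => if i = 0 then u 1 else if i = 1 then -u 0 else 0
      have hw0 : w 0 = u 1 := by simp [w]
      have hw1 : w 1 = -u 0 := by simp [w]
      have hsign : ∀ i : Fin (n + 1 + 1), i ≠ 0 → i ≠ 1 → 0 < ambientSign 1 c i := by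
        intro i h0 h1
        have : ¬ (i : ℕ) ≤ 1 := by
          intro hle
          rcases Nat.le_one_iff_eq_zero_or_eq_one.1 hle with h | h
          · exact h0 (Fin.ext h)
          · exact h1 (Fin.ext h)
        simp [ambientSign, h0, this]
      have hw : w ≠ 0 := by
        intro h
        rw [h] at hw0 hw1
        refine (ambientForm_pos (s := 1) (c := c) hu0 fun i => ?_).not_gt huu
        by_cases h0 : i = 0
        · left; rw [h0]; simpa using hw1.symm
        by_cases h1 : i = 1
        · left; rw [h1]; simpa using hw0.symm
        exact Or.inr (hsign i h0 h1)
      have hneg : ambientForm 1 c (n + 1) w w < 0 := ambientForm_neg hw fun i => by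
        by_cases h0 : i = 0
        · right; simp [ambientSign, h0, hc]
        by_cases h1 : i = 1
        · right; simp [ambientSign, h1]
        left; simp [w, h0, h1]
      have hwu : ambientForm 1 c (n + 1) u w = 0 := by
        rw [ambientForm_apply, Fin.sum_univ_succ, Fin.sum_univ_succ, Finset.sum_eq_zero]
        · have : (Fin.succ 0 : Fin (n + 1 + 1)) = 1 := rfl
          rw [this, hw0, hw1]
          simp [ambientSign, hc]
          ring
        · intro i _
          have h1 : i.succ.succ ≠ (1 : Fin (n + 1 + 1)) := fun h => by
            have := congrArg Fin.val h
            simp at this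
          simp [w, h1]
      obtain ⟨X, t, r, he⟩ := hdec w
      have hr : r = 0 := by
        rw [he, map_add, map_add, map_smul, map_smul, huL, huv] at hwu
        simpa [hu] using hwu
      rw [he, hvv, hr] at hneg
      have := hLnn X
      by_contra hge
      nlinarith [mul_nonneg (sq_nonneg t) (not_lt.1 hge)]
    · have huu : 0 < ambientForm 1 c (n + 1) u u :=
        lt_of_le_of_ne (not_lt.1 fun h => hc (huc.1 h)) hu.symm
      have hneg : ambientForm 1 c (n + 1) (Pi.single 1 1) (Pi.single 1 1) < 0 :=
        ambientForm_neg (by simp) fun i => by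
          by_cases h1 : i = 1
          · right; simp [ambientSign, h1]
          · left; simp [h1]
      obtain ⟨X, t, r, he⟩ := hdec (Pi.single 1 1)
      rw [he, hvv] at hneg
      have := hLnn X
      by_contra hge
      nlinarith [mul_nonneg (sq_nonneg t) (not_lt.1 hge), mul_nonneg (sq_nonneg r) huu.le]

/-- Orthogonality to `u` and to the image of `L` imposes `n + 1` linear conditions on `n + 2`
coordinates; `normal_sign` allows a non-zero solution to be normalised. -/
theorem exists_unit_normal (hs : s = 0 ∨ s = 1) (hT : Module.finrank ℝ T = n)
    (hL : ∀ X, X ≠ 0 → 0 < ambientForm s c (n + 1) (L X) (L X))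
    (hu : ambientForm s c (n + 1) u u ≠ 0) (huc : ambientForm s c (n + 1) u u < 0 ↔ c < 0)
    (huL : ∀ X, ambientForm s c (n + 1) u (L X) = 0) :
    ∃ v, ambientForm s c (n + 1) u v = 0 ∧ (∀ X, ambientForm s c (n + 1) v (L X) = 0) ∧
      ambientForm s c (n + 1) v v = sgn s := by
  let K : (Fin (n + 1 + 1) → ℝ) →ₗ[ℝ] (T →ₗ[ℝ] ℝ) × ℝ :=
    ((ambientForm s c (n + 1)).compl₁₂ LinearMap.id L).prod (ambientForm s c (n + 1) u)
  have hK : LinearMap.ker K ≠ ⊥ := by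
    refine LinearMap.ker_ne_bot_of_finrank_lt ?_
    have h1 : Module.finrank ℝ (T →ₗ[ℝ] ℝ) = n := by
      rw [Module.finrank_linearMap, hT, Module.finrank_self, mul_one]
    rw [Module.finrank_prod, h1]
    simp
  obtain ⟨v, hvK, hv⟩ := Submodule.exists_mem_ne_zero_of_ne_bot hK
  rw [LinearMap.mem_ker] at hvK
  have hvL : ∀ X, ambientForm s c (n + 1) v (L X) = 0 := fun X =>
    LinearMap.congr_fun (congrArg Prod.fst hvK) X
  have huv : ambientForm s c (n + 1) u v = 0 := congrArg Prod.snd hvK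
  have hpos := normal_sign hs hT hL hu huc huL hv huv hvL
  have hsq : sgn s * sgn s = 1 := by rcases hs with rfl | rfl <;> norm_num [sgn]
  set q := sgn s * ambientForm s c (n + 1) v v with hq
  refine ⟨(√q)⁻¹ • v, by simp [huv], fun X => by simp [hvL], ?_⟩
  have hvv : ambientForm s c (n + 1) v v = sgn s * q := by
    rw [hq, ← mul_assoc, hsq, one_mul]
  have h0 : (√q)⁻¹ * (√q)⁻¹ * q = 1 := by
    rw [← mul_inv, Real.mul_self_sqrt hpos.le, inv_mul_cancel₀ hpos.ne']
  simp only [map_smul, LinearMap.smul_apply, smul_eq_mul, hvv]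
  linear_combination sgn s * h0

end Ambient

/-! ### The Gauss equations of isometric immersions. -/

section Immersions

variable {n : ℕ} {M : Type*} [TopologicalSpace M] [ChartedSpace (EuclideanSpace ℝ (Fin n)) M]

/-- The map `f` read in the preferred chart at `x` and in the ambient space. -/
def inChart {s : ℕ} {c : ℝ} (f : M → spaceForm s c (n + 1)) (x : M) :
    EuclideanSpace ℝ (Fin n) → (Fin (n + 1 + 1) → ℝ) :=
  toAmbient f ∘ (extChartAt (𝓡 n) x).symm

theorem finrank_tangentSpace (x : M) : Module.finrank ℝ (TangentSpace (𝓡 n) x) = n :=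
  finrank_euclideanSpace_fin

theorem natCast_le_infty (k : ℕ) : (k : WithTop ℕ∞) ≤ ∞ :=
  WithTop.coe_le_coe.2 le_top

variable [IsManifold (𝓡 n) ∞ M] {g : Metric n M} {s : ℕ} {c : ℝ} {f : M → spaceForm s c (n + 1)}

namespace IsIsometricImmersion

theorem contDiffAt_inChart (hf : IsIsometricImmersion g f) (x : M) :
    ContDiffAt ℝ ∞ (inChart f x) (extChartAt (𝓡 n) x x) := by
  have h := (contMDiffAt_iff.1 (hf.smooth x)).2
  rw [ModelWithCorners.range_eq_univ, contDiffWithinAt_univ] at h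
  exact h

theorem differential_eq (hf : IsIsometricImmersion g f) (x : M) :
    differential f x = fderiv ℝ (inChart f x) (extChartAt (𝓡 n) x x) := by
  have := ((hf.smooth x).mdifferentiableAt (by simp)).mfderiv
  rw [differential, this, ModelWithCorners.range_eq_univ, fderivWithin_univ]
  rfl

/-- The right side does not involve `f`: two immersions induce the same products on the whole chart,
so these can be differentiated. -/
theorem inner_fderiv_inChart (hf : IsIsometricImmersion g f) (x : M)
    {z : EuclideanSpace ℝ (Fin n)} (hz : z ∈ (extChartAt (𝓡 n) x).target)
    (X Y : EuclideanSpace ℝ (Fin n)) :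
    ambientForm s c (n + 1) (fderiv ℝ (inChart f x) z X) (fderiv ℝ (inChart f x) z Y) =
      g.inner ((extChartAt (𝓡 n) x).symm z)
        (mfderiv 𝓘(ℝ, EuclideanSpace ℝ (Fin n)) (𝓡 n) (extChartAt (𝓡 n) x).symm z X)
        (mfderiv 𝓘(ℝ, EuclideanSpace ℝ (Fin n)) (𝓡 n) (extChartAt (𝓡 n) x).symm z Y) := by
  have h1 : MDifferentiableAt 𝓘(ℝ, EuclideanSpace ℝ (Fin n)) (𝓡 n)
      (extChartAt (𝓡 n) x).symm z :=
    (((contMDiffOn_extChartAt_symm (n := ∞) x).contMDiffAt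
      ((isOpen_extChartAt_target x).mem_nhds hz))).mdifferentiableAt (by simp)
  have h2 := (hf.smooth ((extChartAt (𝓡 n) x).symm z)).mdifferentiableAt (by simp)
  have h3 : ∀ X, fderiv ℝ (inChart f x) z X = differential f ((extChartAt (𝓡 n) x).symm z)
      (mfderiv 𝓘(ℝ, EuclideanSpace ℝ (Fin n)) (𝓡 n) (extChartAt (𝓡 n) x).symm z X) := by
    intro X
    rw [← mfderiv_eq_fderiv]
    exact mfderiv_comp_apply z h2 h1 X
  rw [h3, h3]
  exact hf.isometric _ _ _

theorem hessian_comm (hf : IsIsometricImmersion g f) (x : M) (X Y : TangentSpace (𝓡 n) x) :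
    hessian f x X Y = hessian f x Y X :=
  (((hf.contDiffAt_inChart x).of_le (natCast_le_infty 2)).isSymmSndFDerivAt
    (by simp)).eq X Y

theorem secondForm_comm (hf : IsIsometricImmersion g f) (x : M) (v : Fin (n + 1 + 1) → ℝ)
    (X Y : TangentSpace (𝓡 n) x) : secondForm f x v X Y = secondForm f x v Y X := by
  change ambientForm _ _ _ (hessian f x X Y) v = ambientForm _ _ _ (hessian f x Y X) v
  rw [hf.hessian_comm]

theorem shapeOperator_comm (hf : IsIsometricImmersion g f) (x : M) (v : Fin (n + 1 + 1) → ℝ)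
    (X Y : TangentSpace (𝓡 n) x) :
    metricForm g x (shapeOperator g f x v X) Y = metricForm g x X (shapeOperator g f x v Y) := by
  have h : metricForm g x X (shapeOperator g f x v Y) =
    metricForm g x (shapeOperator g f x v Y) X := g.symm x _ _
  rw [h]
  exact (inner_shapeOperator g f x v X Y).trans
    ((hf.secondForm_comm x v X Y).trans (inner_shapeOperator g f x v Y X).symm)

/-- The space form has a transversal `u` at `f x`: the position vector if `c ≠ 0`, the normal of
the hyperplane if `c = 0`. The second derivative of `f` has the component `-c ⟨X, Y⟩` along the
position vector. -/
theorem exists_transversal (hf : IsIsometricImmersion g f) (x : M) :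
    ∃ u : Fin (n + 1 + 1) → ℝ, ambientForm s c (n + 1) u u ≠ 0 ∧
      (ambientForm s c (n + 1) u u < 0 ↔ c < 0) ∧
      (∀ v, IsTangent s c (n + 1) (toAmbient f x) v ↔ ambientForm s c (n + 1) u v = 0) ∧
      (∀ X, ambientForm s c (n + 1) u (differential f x X) = 0) ∧
      ∀ X Y Z W, ambientForm s c (n + 1) u (hessian f x X Y) *
        ambientForm s c (n + 1) u (hessian f x Z W) =
          c * ambientForm s c (n + 1) u u * (g.inner x X Y * g.inner x Z W) := by
  set y := extChartAt (𝓡 n) x x with hy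
  let B := (ambientForm s c (n + 1)).toContinuousBilinearMap
  have hBB : ∀ p q, B p q = ambientForm s c (n + 1) p q := fun p q => rfl
  have hcd := hf.contDiffAt_inChart x
  have hdiff : ∀ᶠ z in nhds y, DifferentiableAt ℝ (inChart f x) z := by
    filter_upwards [(hcd.of_le (m := 1) (by simp)).eventually (by simp)] with z hz
    exact hz.differentiableAt (by simp)
  have hd2 : DifferentiableAt ℝ (fderiv ℝ (inChart f x)) y :=
    (hcd.fderiv_right (m := 1) (natCast_le_infty 2)).differentiableAt (by simp)
  have hval : inChart f x y = toAmbient f x := by simp [inChart, hy]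
  have hmem : ∀ z, inChart f x z ∈ spaceForm s c (n + 1) := fun z => (f _).2
  -- The product form of the last clause suits both cases: for `c = 0` both sides vanish; otherwise
  -- the two components are `-g` and `c ⟨u, u⟩ = 1`.
  rcases eq_or_ne c 0 with hc | hc
  · have hu : ∀ v : Fin (n + 1 + 1) → ℝ, ambientForm s c (n + 1) (Pi.single 0 1) v = v 0 := by
      intro v
      rw [ambientForm_apply, Finset.sum_eq_single 0]
      · simp [ambientSign, hc]
      · intro i _ hi
        simp [hi]
      · simp
    have h0 : ∀ z, B (Pi.single 0 1) (inChart f x z) = 0 := fun z => by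
      have := hmem z
      simp only [spaceForm, hc, if_true, Set.mem_ofPred_eq] at this
      rw [hBB, hu, this]
    have h1 : ∀ᶠ z in nhds y, ∀ X, B (Pi.single 0 1) (fderiv ℝ (inChart f x) z X) = 0 := by
      filter_upwards [hdiff] with z hz X
      have e := (B (Pi.single 0 1)).hasFDerivAt.comp z hz.hasFDerivAt
      have e' := e.unique ((hasFDerivAt_const (0 : ℝ) z).congr_of_eventuallyEq
        (Filter.Eventually.of_forall h0))
      simpa using congrArg (fun l => l X) e'
    have h2 : ∀ X Y, B (Pi.single 0 1) (fderiv ℝ (fderiv ℝ (inChart f x)) y X Y) = 0 := by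
      intro X Y
      have e := (B (Pi.single 0 1)).hasFDerivAt.comp y
        (hd2.hasFDerivAt.clm_apply (hasFDerivAt_const Y y))
      have e' := e.unique ((hasFDerivAt_const (0 : ℝ) y).congr_of_eventuallyEq
        (h1.mono fun z hz => hz Y))
      simpa using congrArg (fun l => l X) e'
    refine ⟨Pi.single 0 1, ?_, ?_, fun v => ?_, fun X => ?_, fun X Y Z W => ?_⟩
    · rw [hu]; simp
    · rw [hu]; simp [hc]
    · rw [hu]; simp [IsTangent, hc]
    · rw [hf.differential_eq]
      exact h1.self_of_nhds X
    · have : ambientForm s c (n + 1) (Pi.single 0 1) (hessian f x X Y) = 0 := h2 X Y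
      rw [this, zero_mul, mul_assoc, mul_eq_zero_of_left hc]
  · have hBc : ∀ p q, B p q = B q p := ambientForm_comm
    have h0 : ∀ z, B (inChart f x z) (inChart f x z) = 1 / c := fun z => by
      have := hmem z
      simp only [spaceForm, if_neg hc, Set.mem_ofPred_eq] at this
      rw [hBB, this]
    have h1 : ∀ᶠ z in nhds y, ∀ X, B (inChart f x z) (fderiv ℝ (inChart f x) z X) = 0 := by
      filter_upwards [hdiff] with z hz X
      have e := B.hasFDerivAt_of_bilinear hz.hasFDerivAt hz.hasFDerivAt
      have e' := e.unique ((hasFDerivAt_const (1 / c : ℝ) z).congr_of_eventuallyEq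
        (Filter.Eventually.of_forall h0))
      have e2 : B (inChart f x z) (fderiv ℝ (inChart f x) z X) +
          B (fderiv ℝ (inChart f x) z X) (inChart f x z) = 0 := by
        simpa using congrArg (fun l => l X) e'
      rw [hBc (fderiv ℝ (inChart f x) z X)] at e2
      linarith
    have h2 : ∀ X Y, B (inChart f x y) (fderiv ℝ (fderiv ℝ (inChart f x)) y X Y) =
        - B (fderiv ℝ (inChart f x) y X) (fderiv ℝ (inChart f x) y Y) := by
      intro X Y
      have e := B.hasFDerivAt_of_bilinear hdiff.self_of_nhds.hasFDerivAt
        (hd2.hasFDerivAt.clm_apply (hasFDerivAt_const Y y))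
      have e' := e.unique ((hasFDerivAt_const (0 : ℝ) y).congr_of_eventuallyEq
        (h1.mono fun z hz => hz Y))
      have e2 : B (inChart f x y) (fderiv ℝ (fderiv ℝ (inChart f x)) y X Y) +
          B (fderiv ℝ (inChart f x) y X) (fderiv ℝ (inChart f x) y Y) = 0 := by
        simpa using congrArg (fun l => l X) e'
      linarith
    have h3 : ∀ X Y, ambientForm s c (n + 1) (toAmbient f x) (hessian f x X Y) =
        - g.inner x X Y := by
      intro X Y
      rw [← hf.isometric, hf.differential_eq, ← hval]
      exact h2 X Y
    have huu : ambientForm s c (n + 1) (toAmbient f x) (toAmbient f x) = 1 / c := by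
      rw [← hval]; exact h0 y
    refine ⟨toAmbient f x, ?_, ?_, fun v => ?_, fun X => ?_, fun X Y Z W => ?_⟩
    · rw [huu]; exact one_div_ne_zero hc
    · rw [huu]; exact one_div_neg
    · simp [IsTangent, hc]
    · rw [hf.differential_eq, ← hval]
      exact h1.self_of_nhds X
    · rw [h3, h3, huu]
      field_simp

theorem differential_pos (hf : IsIsometricImmersion g f) (x : M) (X : TangentSpace (𝓡 n) x)
    (hX : X ≠ 0) : 0 < ambientForm s c (n + 1) (differential f x X) (differential f x X) := by
  rw [hf.isometric]
  exact g.pos x X hX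

theorem exists_isUnitNormal (hf : IsIsometricImmersion g f) (hs : s = 0 ∨ s = 1) (x : M) :
    ∃ v, IsUnitNormal f x v := by
  obtain ⟨u, hu, huc, hut, huL, -⟩ := hf.exists_transversal x
  obtain ⟨v, h1, h2, h3⟩ := exists_unit_normal (L := (differential f x).toLinearMap) hs
    (finrank_tangentSpace x) (hf.differential_pos x) hu huc huL
  exact ⟨v, (hut v).2 h1, h2, h3⟩

/-- The Gauss formula: the second derivative is the sum of a tangential part, which is determined
by its products with the differential, of the second fundamental form, and of a multiple of the
position vector. -/
theorem inner_hessian (hf : IsIsometricImmersion g f) (hs : s = 0 ∨ s = 1) {x : M}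
    {v : Fin (n + 1 + 1) → ℝ} (hv : IsUnitNormal f x v) (X Y : TangentSpace (𝓡 n) x) :
    ∃ G : TangentSpace (𝓡 n) x,
      (∀ Z, ambientForm s c (n + 1) (hessian f x X Y) (differential f x Z) = g.inner x G Z) ∧
      ∀ Z W, ambientForm s c (n + 1) (hessian f x X Y) (hessian f x Z W) =
        ambientForm s c (n + 1) (hessian f x Z W) (differential f x G) +
          sgn s * (secondForm f x v X Y * secondForm f x v Z W) +
          c * (g.inner x X Y * g.inner x Z W) := by
  obtain ⟨u, hu, huc, hut, huL, huh⟩ := hf.exists_transversal x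
  have hsq : sgn s * sgn s = 1 := by rcases hs with rfl | rfl <;> norm_num [sgn]
  have hv0 : v ≠ 0 := by
    rintro rfl
    have := hv.unit
    rw [map_zero] at this
    rw [← this] at hsq
    simp at hsq
  have huv := (hut v).1 hv.tangent
  obtain ⟨G, t, r, he⟩ := exists_decomposition (L := (differential f x).toLinearMap)
    (finrank_tangentSpace x) (hf.differential_pos x) hu huL hv0 huv hv.normal (hessian f x X Y)
  have he' : hessian f x X Y = differential f x G + t • v + r • u := he
  have hsf : ∀ Z W, secondForm f x v Z W = ambientForm s c (n + 1) v (hessian f x Z W) :=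
    fun Z W => ambientForm_comm _ _
  have ht : secondForm f x v X Y = t * sgn s := by
    rw [hsf, he']
    simp [hv.normal, hv.unit, ambientForm_comm v u, huv]
  have hr : ambientForm s c (n + 1) u (hessian f x X Y) = r * ambientForm s c (n + 1) u u := by
    rw [he']
    simp [huL, huv]
  refine ⟨G, fun Z => ?_, fun Z W => ?_⟩
  · rw [he']
    simp [hv.normal, huL, hf.isometric]
  · have e1 := huh X Y Z W
    rw [hr] at e1
    have e2 : r * ambientForm s c (n + 1) u (hessian f x Z W) =
        c * (g.inner x X Y * g.inner x Z W) := by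
      refine mul_left_cancel₀ hu ?_
      linear_combination e1
    rw [ht, hsf Z W, ← e2, ambientForm_comm (hessian f x Z W)]
    conv_lhs => rw [he']
    simp only [map_add, map_smul, LinearMap.add_apply, LinearMap.smul_apply, smul_eq_mul]
    linear_combination (-t * ambientForm s c (n + 1) v (hessian f x Z W)) * hsq

variable {s' : ℕ} {c' : ℝ} {f' : M → spaceForm s' c' (n + 1)}

/-- Two isometric immersions of the same Riemannian manifold have the same Christoffel symbols and
the same curvature tensor. -/
theorem hessian_pair (hf : IsIsometricImmersion g f) (hf' : IsIsometricImmersion g f') (x : M) :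
    (∀ X Y Z, ambientForm s c (n + 1) (hessian f x X Y) (differential f x Z) =
      ambientForm s' c' (n + 1) (hessian f' x X Y) (differential f' x Z)) ∧
    ∀ X Y Z W, ambientForm s c (n + 1) (hessian f x X Z) (hessian f x Y W) -
        ambientForm s c (n + 1) (hessian f x X W) (hessian f x Y Z) =
      ambientForm s' c' (n + 1) (hessian f' x X Z) (hessian f' x Y W) -
        ambientForm s' c' (n + 1) (hessian f' x X W) (hessian f' x Y Z) := by
  set y := extChartAt (𝓡 n) x x with hy
  let P := Fin (n + 1 + 1) → ℝ
  -- For the difference of the two forms, equality of the induced metrics says that `(f, f')` has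
  -- isotropic differential.
  let b₀ : LinearMap.BilinForm ℝ (P × P) :=
    (ambientForm s c (n + 1)).compl₁₂ (LinearMap.fst ℝ P P) (LinearMap.fst ℝ P P) -
      (ambientForm s' c' (n + 1)).compl₁₂ (LinearMap.snd ℝ P P) (LinearMap.snd ℝ P P)
  let b := b₀.toContinuousBilinearMap
  have hb : ∀ p q, b p q =
      ambientForm s c (n + 1) p.1 q.1 - ambientForm s' c' (n + 1) p.2 q.2 := fun p q => rfl
  have hsymm : ∀ p q, b p q = b q p := fun p q => by
    rw [hb, hb, ambientForm_comm p.1, ambientForm_comm p.2]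
  let Φ : EuclideanSpace ℝ (Fin n) → P × P := fun z => (inChart f x z, inChart f' x z)
  have hcd := hf.contDiffAt_inChart x
  have hcd' := hf'.contDiffAt_inChart x
  have hΦ : ContDiffAt ℝ ∞ Φ y := hcd.prodMk hcd'
  have hder : ∀ᶠ z in nhds y, ∀ X, fderiv ℝ Φ z X =
      (fderiv ℝ (inChart f x) z X, fderiv ℝ (inChart f' x) z X) := by
    filter_upwards [(hcd.of_le (m := 1) (by simp)).eventually (by simp),
      (hcd'.of_le (m := 1) (by simp)).eventually (by simp)] with z hz hz' X
    rw [((hz.differentiableAt (by simp)).hasFDerivAt.prodMk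
      (hz'.differentiableAt (by simp)).hasFDerivAt).fderiv]
    rfl
  have hd : ∀ {F : Type} [NormedAddCommGroup F] [NormedSpace ℝ F]
      {φ : EuclideanSpace ℝ (Fin n) → F}, ContDiffAt ℝ ∞ φ y →
      DifferentiableAt ℝ (fderiv ℝ φ) y := fun h =>
    (h.fderiv_right (m := 1) (natCast_le_infty 2)).differentiableAt (by simp)
  have hder2 : ∀ X Y, fderiv ℝ (fderiv ℝ Φ) y X Y = (hessian f x X Y, hessian f' x X Y) := by
    intro X Y
    have e1 := (hd hΦ).hasFDerivAt.clm_apply (hasFDerivAt_const Y y)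
    have e2 := ((hd hcd).hasFDerivAt.clm_apply (hasFDerivAt_const Y y)).prodMk
      ((hd hcd').hasFDerivAt.clm_apply (hasFDerivAt_const Y y))
    have e3 := e1.unique (e2.congr_of_eventuallyEq (hder.mono fun z hz => hz Y))
    have e4 := congrArg (fun l => l X) e3
    simp at e4
    exact e4
  have hiso : ∀ᶠ z in nhds y, ∀ X Y, b (fderiv ℝ Φ z X) (fderiv ℝ Φ z Y) = 0 := by
    filter_upwards [hder, extChartAt_target_mem_nhds (I := 𝓡 n) x] with z hz hz' X Y
    rw [hz, hz, hb, hf.inner_fderiv_inChart x hz', hf'.inner_fderiv_inChart x hz', sub_self]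
  refine ⟨fun X Y Z => ?_, fun X Y Z W => ?_⟩
  · have e := second_deriv_orthogonal hsymm (hΦ.of_le (natCast_le_infty 2)) hiso X Y Z
    have k := congrArg₂ (fun p q => b p q) (hder2 X Y) (hder.self_of_nhds Z)
    rw [hf.differential_eq, hf'.differential_eq]
    exact sub_eq_zero.1 (k.symm.trans e)
  · have e := second_deriv_flat hsymm (hΦ.of_le (natCast_le_infty 3)) hiso X Y Z W
    have k1 := congrArg₂ (fun p q => b p q) (hder2 X Z) (hder2 Y W)
    have k2 := congrArg₂ (fun p q => b p q) (hder2 X W) (hder2 Y Z)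
    have k := k1.symm.trans (e.trans k2)
    simp only [hb] at k
    linarith

/-- The tangential parts `G`, `G'` of the second derivatives agree, and so do their contributions;
only the normal and transversal terms survive in the curvature identity. -/
theorem gaussPair (hf : IsIsometricImmersion g f) (hf' : IsIsometricImmersion g f')
    (hs : s = 0 ∨ s = 1) (hs' : s' = 0 ∨ s' = 1) {x : M} {v v' : Fin (n + 1 + 1) → ℝ}
    (hv : IsUnitNormal f x v) (hv' : IsUnitNormal f' x v') :
    GaussPair (metricForm g x) (c - c') (sgn s) (sgn s') (shapeOperator g f x v)
      (shapeOperator g f' x v') := by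
  obtain ⟨h1, h2⟩ := hf.hessian_pair hf' x
  have key : ∀ X Y Z W, ambientForm s c (n + 1) (hessian f x X Y) (hessian f x Z W) -
      sgn s * (secondForm f x v X Y * secondForm f x v Z W) -
      c * (g.inner x X Y * g.inner x Z W) =
      ambientForm s' c' (n + 1) (hessian f' x X Y) (hessian f' x Z W) -
      sgn s' * (secondForm f' x v' X Y * secondForm f' x v' Z W) -
      c' * (g.inner x X Y * g.inner x Z W) := by
    intro X Y Z W
    obtain ⟨G, hG, hG2⟩ := hf.inner_hessian hs hv X Y
    obtain ⟨G', hG', hG2'⟩ := hf'.inner_hessian hs' hv' X Y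
    have hGG : G = G' := by
      by_contra hne
      have := g.pos x (G - G') (sub_ne_zero.2 hne)
      rw [map_sub (g.inner x), sub_apply, ← hG, ← hG', h1, sub_self] at this
      exact lt_irrefl _ this
    rw [hG2, hG2', ← hGG, h1]
    ring
  intro X Y Z W
  have hA : ∀ X Y, metricForm g x (shapeOperator g f x v X) Y = secondForm f x v X Y :=
    inner_shapeOperator g f x v
  have hA' : ∀ X Y, metricForm g x (shapeOperator g f' x v' X) Y = secondForm f' x v' X Y :=
    inner_shapeOperator g f' x v'
  have hg : ∀ X Y, metricForm g x X Y = g.inner x X Y := fun X Y => rfl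
  simp only [hA, hA', hg]
  linear_combination h2 X Y Z W - key X Z Y W + key X W Y Z

end IsIsometricImmersion

end Immersions

end SpaceForms

end

/-! ### The theorem on pairs of isometric immersions. -/

theorem theorem1 {n : ℕ} (hn : 4 ≤ n) {M : Type*} [TopologicalSpace M]
    [ChartedSpace (EuclideanSpace ℝ (Fin n)) M] [IsManifold (𝓡 n) ∞ M] [Nonempty M]
    (g : SpaceForms.Metric n M)
    (s s' : ℕ) (hs : s = 0 ∨ s = 1) (hs' : s' = 0 ∨ s' = 1) (c c' : ℝ) (hc : c' ≠ c)
    (f : M → SpaceForms.spaceForm s c (n + 1)) (hf : SpaceForms.IsIsometricImmersion g f)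
    (f' : M → SpaceForms.spaceForm s' c' (n + 1)) (hf' : SpaceForms.IsIsometricImmersion g f') :
    (s = 0 ∧ s' = 1 → c < c') ∧
    (s = 1 ∧ s' = 0 → c' < c) ∧
    ∀ x : M,
      (∃ v, SpaceForms.IsUnitNormal f x v) ∧ (∃ v', SpaceForms.IsUnitNormal f' x v') ∧
      ∀ v, SpaceForms.IsUnitNormal f x v →
        ∃ κ : ℝ, n - 1 ≤ SpaceForms.multiplicity g f x v κ ∧
          ∀ v', SpaceForms.IsUnitNormal f' x v' →
            ((κ = 0 ∨
                (SpaceForms.IsUmbilicalWith g f x v κ ∧ c + SpaceForms.sgn s * κ ^ 2 ≠ c')) →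
              ∃ κ' : ℝ, SpaceForms.IsUmbilicalWith g f' x v' κ') ∧
            (SpaceForms.IsUmbilicalWith g f x v κ ∧ c + SpaceForms.sgn s * κ ^ 2 = c' →
              n - 1 ≤ SpaceForms.multiplicity g f' x v' 0) ∧
            (κ ≠ 0 ∧ SpaceForms.multiplicity g f x v κ = n - 1 →
              ∃ κ' : ℝ, SpaceForms.principalSpace g f' x v' κ' =
                SpaceForms.principalSpace g f x v κ) := by
  have point : ∀ {s s' : ℕ} {c c' : ℝ} (_ : s = 0 ∨ s = 1) (_ : s' = 0 ∨ s' = 1) (_ : c' ≠ c)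
      {f : M → SpaceForms.spaceForm s c (n + 1)} (_ : SpaceForms.IsIsometricImmersion g f)
      {f' : M → SpaceForms.spaceForm s' c' (n + 1)} (_ : SpaceForms.IsIsometricImmersion g f')
      (x : M) (v v₀' : Fin (n + 1 + 1) → ℝ) (_ : SpaceForms.IsUnitNormal f x v)
      (_ : SpaceForms.IsUnitNormal f' x v₀'), _ :=
    fun {s s' c c'} hs hs' hc f hf f' hf' x v v₀' hv hv₀' =>
      SpaceForms.exists_principal_curvature (g := SpaceForms.metricForm g x) (D := c - c')
        (ε := SpaceForms.sgn s) (ε' := SpaceForms.sgn s')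
        (A := SpaceForms.shapeOperator g f x v) hn
        (SpaceForms.finrank_tangentSpace x) (g.symm x) (g.pos x)
        (sub_ne_zero.2 hc.symm) (by rcases hs with rfl | rfl <;> norm_num [SpaceForms.sgn])
        (by rcases hs' with rfl | rfl <;> norm_num [SpaceForms.sgn]) (hf.shapeOperator_comm x v)
        ⟨_, hf.gaussPair hf' hs hs' hv hv₀'⟩
  have sign : ∀ {c c' : ℝ} (_ : c' ≠ c)
      {f : M → SpaceForms.spaceForm 0 c (n + 1)} (_ : SpaceForms.IsIsometricImmersion g f)
      {f' : M → SpaceForms.spaceForm 1 c' (n + 1)} (_ : SpaceForms.IsIsometricImmersion g f'),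
      c < c' := by
    intro c c' hc f hf f' hf'
    obtain ⟨x⟩ := ‹Nonempty M›
    obtain ⟨v, hv⟩ := hf.exists_isUnitNormal (Or.inl rfl) x
    obtain ⟨v', hv'⟩ := hf'.exists_isUnitNormal (Or.inr rfl) x
    obtain ⟨κ, -, hκ⟩ := point (Or.inl rfl) (Or.inr rfl) hc hf hf' x v v' hv hv'
    have := (hκ _ (hf'.shapeOperator_comm x v')
      (hf.gaussPair hf' (Or.inl rfl) (Or.inr rfl) hv hv')).1 (by norm_num [SpaceForms.sgn])
      (by norm_num [SpaceForms.sgn])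
    linarith
  refine ⟨?_, ?_, fun x => ?_⟩
  · rintro ⟨rfl, rfl⟩
    exact sign hc hf hf'
  · rintro ⟨rfl, rfl⟩
    -- The first inequality with the two immersions exchanged.
    exact sign hc.symm hf' hf
  -- An auxiliary normal of `f'` yields `κ` before the arbitrary `v'` is introduced.
  obtain ⟨v₀', hv₀'⟩ := hf'.exists_isUnitNormal hs' x
  refine ⟨hf.exists_isUnitNormal hs x, ⟨v₀', hv₀'⟩, fun v hv => ?_⟩
  obtain ⟨κ, hmult, hκ⟩ := point hs hs' hc hf hf' x v v₀' hv hv₀'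
  refine ⟨κ, hmult, fun v' hv' => ?_⟩
  obtain ⟨-, h1, h2, h3⟩ := hκ _ (hf'.shapeOperator_comm x v') (hf.gaussPair hf' hs hs' hv hv')
  refine ⟨fun h => h1 (h.imp_right fun h => ⟨h.1, fun h0 => h.2 (by linarith)⟩),
    fun h => h2 ⟨h.1, by linarith [h.2]⟩, h3⟩
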